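/- **Giambelli-type formula for dual refined canonical stable Grothendieck polynomials.** *Notation.* Let $e_n(X/Y)=\sum_{i=0}^n(-1)^{n-i}e_i(X)h_{n-i}(Y)$ for $n\ge 0$ and $e_n(X/Y)=0$ for $n<0$. For sequences $x,\alpha,\beta$ of elements of a commutative ring (for instance indeterminates) write $\mathbf x_m=(x_1,\dots,x_m)$ and $\overline{\boldsymbol\alpha}_r=(-\alpha_1,\dots,-\alpha_r)$, $\boldsymbol\beta_r=(\beta_1,\dots,\beta_r)$ (empty for $r\le 0$). For partitions $\mu\subseteq\lambda$ with conjugates $\mu',\lambda'$, and any $n\ge\lambda_1$, let $$g_{\lambda/\mu}(\mathbf x_m;\boldsymbol\alpha,\boldsymbol\beta)=\det\left[e_{\lambda'_i-i-\mu'_j+j}(\mathbf x_m,\overline{\boldsymbol\alpha}_{j-1},\boldsymbol\beta_{\lambda'_i-1}\,/\,\overline{\boldsymbol\alpha}_{i-1},\boldsymbol\beta_{\mu'_j})\right]_{1\le i,j\le n}.$$ *Flagged enumerators.* Let $\rho$ be a Young diagram with $N$ columns, of lengths $\rho'_1,\dots,\rho'_N$, whose cells carry the contents $c(i,j)=j-i+s$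 for a fixed shift $s$. Let $\tau_j$ and $\sigma_j$ be the contents of the top and bottom cells of its $j$-th column. For $\mathbf p,\mathbf q\in\mathbb Z^N$ let $$\mathsf g^{\mathbf p,\mathbf q}_\rho(\mathbf x_m;\boldsymbol\alpha,\boldsymbol\beta)=\det\left[e_{\rho'_i-i+j}\big((y_t)_{p_j\le t\le q_i}\,/\,(z_t)_{p_j+\tau_j\le t\le q_i+\sigma_i}\big)\right]_{1\le i,j\le N},$$ where $y_t=x_t$, $z_t=0$ for $1\le t\le m$; $y_t=\beta_{t-m}$, $z_t=-\alpha_{t-m}$ for $t>m$; and $y_t=-\alpha_{1-t}$, $z_t=\beta_{1-t}$ for $t\le 0$. An empty determinant is $1$. *Induced flags.* Let $a_i=-i+2$ and $b_i=\lambda'_i+m-1$. For an integer $c$ let $m(c)$ and $M(c)$ be the leftmost and the rightmost cells of $\lambda/\mu$ with content $c$, where $(i,j)$ has content $j-i$ (by convention both are $(1,1)$ if there is no such cell). The induced flags of $\rho$ are $$p_r=a_{\mathrm{col}(m(\tau_r))}-(\mu'_{\mathrm{col}(m(\tau_r))}+1)+\mathrm{row}(m(\tau_r)),\qquad q_r=b_{\mathrm{col}(M(\sigma_r))}-\lambda'_{\mathrm{col}(M(\sigma_r))}+\mathrm{row}(M(\sigma_r)).$$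 Let $\mathsf g[\rho]$ denote the flagged enumerator of $\rho$ with these induced flags. *Theorem.* Let $\mu\subseteq\lambda$ be partitions, written in Frobenius notation as $\lambda=(u_1,\dots,u_k\mid v_1,\dots,v_k)$ and $\mu=(c_1,\dots,c_\ell\mid d_1,\dots,d_\ell)$, and let $m\ge 0$. Then $$g_{\lambda/\mu}(\mathbf x_m;\boldsymbol\alpha,\boldsymbol\beta)=(-1)^\ell\det\begin{bmatrix}\big[\mathsf g[(u_j\mid v_i)]\big]_{i,j\in[k]}&\big[\mathsf g[1^{v_i-d_j}]\big]_{i\in[k],\,j\in[\ell]}\\[4pt]\big[\mathsf g[(u_j-c_i)]\big]_{i\in[\ell],\,j\in[k]}&\mathbf 0\end{bmatrix}.$$ Here the hook $(u_j\mid v_i)$ (the partition $(u_j+1,1^{v_i})$) has contents from $-v_i$ to $u_j$; the column $1^{v_i-d_j}$ has contents from $-v_i$ to $-d_j-1$; and the row $(u_j-c_i)$ has contents from $c_i+1$ to $u_j$. An entry is $1$ if its strip is empty ($v_i=d_j$, respectively $u_j=c_i$), and $0$ if $v_i<d_j$, respectively $u_j<c_i$. -/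

import Mathlib

namespace DualGroth

/-! ### Supersymmetric functions -/

section Supersymmetric

variable {R : Type*} [CommRing R]

/-- The elementary supersymmetric function
`e_n(f / h) = ∑_{i = 0}^n (-1)^(n - i) e_i(f) h_{n - i}(h)` of two finite families of elements of `R`,
extended by `0` to negative `n`. -/
noncomputable def superE {σ τ : Type} [Fintype σ] [Fintype τ] [DecidableEq σ] [DecidableEq τ]
    (n : ℤ) (f : σ → R) (h : τ → R) : R :=
  if n < 0 then 0
  else ∑ i ∈ Finset.range (n.toNat + 1),
    (-1) ^ (n.toNat - i) * MvPolynomial.aeval f (MvPolynomial.esymm σ ℤ i) *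
      MvPolynomial.aeval h (MvPolynomial.hsymm τ ℤ (n.toNat - i))

/-- The finite family `y_a, y_{a+1}, …, y_b` (empty if `a > b`). -/
def segment (y : ℤ → R) (a b : ℤ) : {i : ℤ // i ∈ Finset.Icc a b} → R := fun i => y i

end Supersymmetric

/-! ### Shapes with shifted contents

Rows and columns are numbered from `0` in the code, as in `YoungDiagram`; so the `j`-th column here
is column `j + 1` in the usual numbering. The content of a cell is not affected. -/

/-- A skew shape `outer / inner` together with its root content, the content of the bottom-left
cell. -/
structure RShape where
  outer : YoungDiagram
  inner : YoungDiagram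
  inner_le : inner ≤ outer
  root : ℤ

namespace RShape

/-- The skew shape `lam / mu` with its usual contents: the root content is `1 - lam'_1`. -/
def usual (lam mu : YoungDiagram) (h : mu ≤ lam) : RShape := ⟨lam, mu, h, 1 - lam.colLen 0⟩

/-- A straight shape with a given root content. -/
def straight (lam : YoungDiagram) (r : ℤ) : RShape := ⟨lam, ⊥, bot_le, r⟩

/-- The number of columns, `λ_1`. -/
def numCols (θ : RShape) : ℕ := θ.outer.rowLen 0

/-- The (shifted) content of the cell in row `i` and column `j`. -/
def content (θ : RShape) (i j : ℤ) : ℤ := j - i + (θ.root - 1 + θ.outer.colLen 0)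

/-- The content of the top cell of column `j`. -/
def topContent (θ : RShape) (j : ℕ) : ℤ := θ.content (θ.inner.colLen j) j

/-- The content of the bottom cell of column `j`. -/
def botContent (θ : RShape) (j : ℕ) : ℤ := θ.content ((θ.outer.colLen j : ℤ) - 1) j

/-- The cells of the skew diagram. -/
def cells (θ : RShape) : Finset (ℕ × ℕ) := θ.outer.cells \ θ.inner.cells

/-- The cells of the skew diagram with content `c`. -/
def diagonal (θ : RShape) (c : ℤ) : Finset (ℕ × ℕ) :=
  θ.cells.filter fun p => θ.content p.1 p.2 = c

/-- The leftmost cell with content `c`. Along a diagonal the row and the column increase together,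
so this cell has the least row and the least column; it is `(0, 0)` by convention if there is no
cell with content `c`. -/
noncomputable def minCell (θ : RShape) (c : ℤ) : ℕ × ℕ :=
  (sInf {i | ∃ j, (i, j) ∈ θ.diagonal c}, sInf {j | ∃ i, (i, j) ∈ θ.diagonal c})

/-- The rightmost cell with content `c`; it is `(0, 0)` by convention if there is no cell with
content `c`. -/
def maxCell (θ : RShape) (c : ℤ) : ℕ × ℕ :=
  ((θ.diagonal c).sup Prod.fst, (θ.diagonal c).sup Prod.snd)

end RShape

/-- The hook `(u | v)`: the partition `(u + 1, 1^v)`. -/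
def hook (u v : ℕ) : YoungDiagram where
  cells := (Finset.range (v + 1) ×ˢ {0}) ∪ ({0} ×ˢ Finset.range (u + 1))
  isLowerSet := by
    rintro ⟨i, j⟩ ⟨i', j'⟩ h hm
    rw [Prod.mk_le_mk] at h
    simp at hm ⊢
    omega

/-- The rectangle with `p` rows and `q` columns (empty if `p = 0` or `q = 0`). -/
def rect (p q : ℕ) : YoungDiagram where
  cells := Finset.range p ×ˢ Finset.range q
  isLowerSet := by
    rintro ⟨i, j⟩ ⟨i', j'⟩ h hm
    rw [Prod.mk_le_mk] at h
    simp at hm ⊢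
    omega

/-- The size of the Durfee square, i.e. the number of diagonal cells. -/
def durfee (lam : YoungDiagram) : ℕ := (lam.cells.filter fun p => p.1 = p.2).card

/-- The number of cells to the right of the diagonal cell `(i, i)`, for `i < durfee lam`. -/
def arm (lam : YoungDiagram) (i : ℕ) : ℕ := lam.rowLen i - (i + 1)

/-- The number of cells below the diagonal cell `(i, i)`, for `i < durfee lam`. -/
def leg (lam : YoungDiagram) (i : ℕ) : ℕ := lam.colLen i - (i + 1)

/-! ### Flagged functions -/

section Flagged

variable {R : Type*} [CommRing R]

/-- The flagged supersymmetric Schur function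
`det [ e_{λ'_i - i - μ'_j + j} (y_{a_j, b_i} / z_{a'_j, b'_i}) ]` with the conjugate flags
`a'_j = a_j + c(top cell of column j)`, `b'_i = b_i + c(bottom cell of column i)`. -/
noncomputable def flaggedSchur (θ : RShape) (a b : ℕ → ℤ) (y z : ℤ → R) : R :=
  (Matrix.of fun i j : Fin θ.numCols =>
    superE ((θ.outer.colLen i : ℤ) - i - θ.inner.colLen j + j)
      (segment y (a j) (b i))
      (segment z (a j + θ.topContent j) (b i + θ.botContent i))).det

/-- The substitution for `y_i`; the sequences `x`, `α`, `β` are indexed from `1`. -/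
def gSpecY (m : ℕ) (x α β : ℕ → R) (i : ℤ) : R :=
  if i ≤ 0 then -α (1 - i).toNat else if i ≤ m then x i.toNat else β (i - m).toNat

/-- The substitution for `z_i`; the sequences `α`, `β` are indexed from `1`. -/
def gSpecZ (m : ℕ) (α β : ℕ → R) (i : ℤ) : R :=
  if i ≤ 0 then β (1 - i).toNat else if i ≤ m then 0 else -α (i - m).toNat

/-- The flagged dual Grothendieck enumerator. -/
noncomputable def flaggedEnum (θ : RShape) (a b : ℕ → ℤ) (m : ℕ) (x α β : ℕ → R) : R :=
  flaggedSchur θ a b (gSpecY m x α β) (gSpecZ m α β)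

/-- The dual refined canonical stable Grothendieck polynomial in `x_1, …, x_m`, as the determinant
`det [ e_{λ'_i - i - μ'_j + j} (x_m, -α_{[j-1]}, β_{[λ'_i - 1]} / -α_{[i-1]}, β_{[μ'_j]}) ]`
of size `n ≥ λ_1` (here `α_{[r]} = (α_1, …, α_r)`). -/
noncomputable def dualGroth (lam mu : YoungDiagram) (n m : ℕ) (x α β : ℕ → R) : R :=
  (Matrix.of fun i j : Fin n =>
    superE ((lam.colLen i : ℤ) - i - mu.colLen j + j)
      (Sum.elim (fun t : Fin m => x (t + 1))
        (Sum.elim (fun t : Fin (j : ℕ) => -α (t + 1))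
          (fun t : Fin (lam.colLen i - 1) => β (t + 1))))
      (Sum.elim (fun t : Fin (i : ℕ) => -α (t + 1))
        (fun t : Fin (mu.colLen j) => β (t + 1)))).det

end Flagged

/-! ### Induced ribbon flags

A ribbon `ρ` whose contents are contents of `θ` is decomposed canonically into its columns. The
flags of `θ` induce flags of `ρ`, indexed by the columns of `ρ`. -/

/-- The lower induced flag:
`a_{col(m_r)} - (μ'_{col(m_r)} + 1) + row(m_r)`, where `m_r` is the leftmost cell of `θ` with the
content of the top cell of the `r`-th column of `ρ`, and rows are numbered from `1`. -/
noncomputable def inducedA (θ : RShape) (a : ℕ → ℤ) (ρ : RShape) (r : ℕ) : ℤ :=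
  let p := θ.minCell (ρ.topContent r)
  a p.2 - ((θ.inner.colLen p.2 : ℤ) + 1) + ((p.1 : ℤ) + 1)

/-- The upper induced flag:
`b_{col(M_r)} - λ'_{col(M_r)} + row(M_r)`, where `M_r` is the rightmost cell of `θ` with the
content of the bottom cell of the `r`-th column of `ρ`, and rows are numbered from `1`. -/
def inducedB (θ : RShape) (b : ℕ → ℤ) (ρ : RShape) (r : ℕ) : ℤ :=
  let p := θ.maxCell (ρ.botContent r)
  b p.2 - (θ.outer.colLen p.2 : ℤ) + ((p.1 : ℤ) + 1)

/-- The flag `a_i = -i + 2`, `i ≥ 1`. -/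
def flagA (i : ℕ) : ℤ := -((i : ℤ) + 1) + 2

/-- The flag `b_i = λ'_i + m - 1`, `i ≥ 1`. -/
def flagB (lam : YoungDiagram) (m : ℕ) (i : ℕ) : ℤ := (lam.colLen i : ℤ) + m - 1

section Entries

variable {R : Type*} [CommRing R]

/-- The flagged dual Grothendieck enumerator of the ribbon `ρ` with the flags induced by the flags
`flagA`, `flagB` of the usual shape `lam / mu`. -/
noncomputable def ribbonEnum (lam mu : YoungDiagram) (h : mu ≤ lam) (ρ : RShape) (m : ℕ)
    (x α β : ℕ → R) : R :=
  let θ := RShape.usual lam mu h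
  flaggedEnum ρ (inducedA θ flagA ρ) (inducedB θ (flagB lam m) ρ) m x α β

/-- The entry of the hook `(u_j | v_i)`, with contents from `-v_i` to `u_j`. -/
noncomputable def hookEntry (lam mu : YoungDiagram) (h : mu ≤ lam) (m : ℕ) (x α β : ℕ → R)
    (i j : ℕ) : R :=
  ribbonEnum lam mu h (.straight (hook (arm lam j) (leg lam i)) (-(leg lam i : ℤ))) m x α β

/-- The entry of the vertical strip `1^{v_i - d_j}`, with contents from `-v_i` to `-d_j - 1`; it is
`1` (an empty determinant) for the empty strip, and `0` if the strip is undefined, `v_i < d_j`. -/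
noncomputable def vertEntry (lam mu : YoungDiagram) (h : mu ≤ lam) (m : ℕ) (x α β : ℕ → R)
    (i j : ℕ) : R :=
  if leg lam i < leg mu j then 0
  else ribbonEnum lam mu h (.straight (rect (leg lam i - leg mu j) 1) (-(leg lam i : ℤ))) m x α β

/-- The entry of the horizontal strip `(u_j - c_i)`, with contents from `c_i + 1` to `u_j`; it is
`1` (an empty determinant) for the empty strip, and `0` if the strip is undefined, `u_j < c_i`. -/
noncomputable def horizEntry (lam mu : YoungDiagram) (h : mu ≤ lam) (m : ℕ) (x α β : ℕ → R)
    (i j : ℕ) : R :=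
  if arm lam j < arm mu i then 0
  else ribbonEnum lam mu h (.straight (rect 1 (arm lam j - arm mu i)) ((arm mu i : ℤ) + 1)) m x α β

end Entries

end DualGroth

/-! Both sides are built from minors of one array `stripWeight`, written W(s, t), indexed by a
bottom content s and a top content t. It vanishes for t < s - 1 and equals 1 at t = s - 1. By
`ribbonEnum_eq_det`, every strip enumerator is the determinant of W at the bottom and top contents
of the strip's columns. By `dualGroth_eq_det`, g_{λ/μ} is the determinant of W at the contents i -
λ'_i + 1 and j - μ'_j (columns counted from 0).

Let P = (W(s + 1, t)) for 0 ≤ s, t < n, a unitriangular matrix. In Frobenius coordinates the first k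
rows of the matrix for g_{λ/μ} have s = -v_i and the first ℓ columns have t = -d_j - 1. The
remaining rows and columns are rows and columns of P, and the block with s ≥ 1 and t ≤ -1 is zero.
The row indices of P that do not occur are the arms u_j, and the missing column indices are the arms
c_i. This is the complementarity of the arms with the numbers i - λ'_i for i ≥ k, encoded by
`frobeniusPerm`. So the matrix is P, permuted, with k rows and ℓ columns replaced.

Jacobi's complementary minor identity (`det_mul_det_inverse`) turns its determinant into a bordered
determinant of size k + ℓ in entries of P⁻¹. Solving the triangular system by Hessenberg
determinants (`det_cons_hessenberg`) identifies these entries, up to the signs (-1)^{u_j} and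
(-1)^{c_i}, with hook and row enumerators (`hookEntry_eq`, `horizEntry_eq`). The border entries
W(-v_i, -d_j - 1) are the column enumerators. The signs cancel against those of the two permutations
(`sign_frobeniusPerm`). -/

namespace DualGroth

/-! ### Determinant identities: Cramer's rule, irrelevant rows and columns, Jacobi's identity. -/

section LinearAlgebra

variable {R : Type*} [CommRing R]

/-- A unitriangular matrix has determinant `1`. -/
theorem det_unitriangular {N : ℕ} (P : Matrix (Fin N) (Fin N) R)
    (h0 : ∀ i j, j < i → P i j = 0) (h1 : ∀ i, P i i = 1) : P.det = 1 := by
  have hP : P.IsUpperTriangular := fun i j hij => h0 i j hij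
  rw [Matrix.det_of_isUpperTriangular hP]
  simp [h1]

/-- Replacing the last row of a unitriangular matrix by `∑ w_s P_s` and moving it to the top
multiplies the determinant by `(-1)^u w_u`. -/
theorem det_cons_combination {u : ℕ} (p : Fin (u + 1) → Fin (u + 1) → R)
    (h0 : ∀ i j, j < i → p i j = 0) (h1 : ∀ i, p i i = 1) (w q : Fin (u + 1) → R)
    (hq : ∀ t, ∑ s, w s * p s t = q t) :
    (Matrix.of fun i j : Fin (u + 1) =>
      (Fin.cons (q j) (fun s : Fin u => p s.castSucc j) : Fin (u + 1) → R) i).det =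
      (-1) ^ u * w (Fin.last u) := by
  set N : Matrix (Fin (u + 1)) (Fin (u + 1)) R := Matrix.of fun i j =>
    (Fin.cons (p (Fin.last u) j) (fun s : Fin u => p s.castSucc j) : Fin (u + 1) → R) i with hN
  -- Moving the last row to the top is a cycle of length u + 1, of sign (-1)^u. Replacing that top
  -- row by a combination of all rows then scales the determinant by its own coefficient `w
  -- (Fin.last u)`.
  have hrot : (Matrix.of p) = N.submatrix (finRotate (u + 1)) id := by
    ext i j
    refine Fin.lastCases ?_ (fun s => ?_) i
    · simp [hN]
    · simp [hN]
  have hdN : N.det = (-1) ^ u := by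
    have h2 : (Matrix.of p).det = 1 := det_unitriangular _ h0 h1
    rw [hrot, Matrix.det_permute, sign_finRotate] at h2
    push_cast at h2
    calc N.det = ((-1) ^ u * (-1) ^ u) * N.det := by rw [← mul_pow]; simp
      _ = _ := by rw [mul_assoc, h2, mul_one]
  have hH : (Matrix.of fun i j : Fin (u + 1) =>
      (Fin.cons (q j) (fun s : Fin u => p s.castSucc j) : Fin (u + 1) → R) i) =
      N.updateRow 0 (∑ s, (Fin.cons (w (Fin.last u)) (fun s : Fin u => w s.castSucc) :
        Fin (u + 1) → R) s • N s) := by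
    ext i j
    refine Fin.cases ?_ (fun s => ?_) i
    · rw [Matrix.updateRow_self, Matrix.of_apply, Fin.cons_zero, ← hq, Fin.sum_univ_castSucc,
        Fin.sum_univ_succ, add_comm]
      simp [hN, Finset.sum_apply]
    · simp [hN, Matrix.updateRow_ne]
  rw [hH, Matrix.det_updateRow_sum, hdN, Fin.cons_zero, smul_eq_mul, mul_comm]

/-- Two matrices that differ only in rows and columns of a set `S` of indices, at which both are
block triangular with the same diagonal entry, have the same determinant. -/
theorem det_congr_of_blockTriangular {N : ℕ} (A B : Matrix (Fin N) (Fin N) R) (S : Fin N → Prop)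
    (hA : ∀ s, S s → ∀ i j, s ≤ i → j ≤ s → ¬(i = s ∧ j = s) → A i j = 0)
    (hB : ∀ s, S s → ∀ i j, s ≤ i → j ≤ s → ¬(i = s ∧ j = s) → B i j = 0)
    (hd : ∀ s, S s → A s s = B s s) (hAB : ∀ i j, ¬S i → ¬S j → A i j = B i j) :
    A.det = B.det := by
  -- A permutation that moves s has a factor in the vanishing region at s. If f s < s, this is the
  -- pigeonhole principle: f cannot map the indices ≤ s into those < s. So only permutations fixing
  -- S pointwise contribute.
  have key : ∀ (f : Equiv.Perm (Fin N)) (s : Fin N), f s ≠ s → ∃ j ≤ s, s ≤ f j ∧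
      ¬(f j = s ∧ j = s) := by
    intro f s hs
    rcases lt_or_gt_of_ne hs with h | h
    · by_contra! hc
      have : ∀ j ∈ Finset.Iic s, f j ∈ Finset.Iio s := by
        intro j hj
        rw [Finset.mem_Iic] at hj
        rw [Finset.mem_Iio]
        by_contra hj'
        have := hc j hj (not_lt.mp hj')
        rw [this.2] at hj'
        exact hj' h
      have := Finset.card_le_card_of_injOn f this f.injective.injOn
      simp at this
    · exact ⟨s, le_rfl, h.le, fun h' => hs h'.1⟩
  rw [Matrix.det_apply, Matrix.det_apply]
  refine Finset.sum_congr rfl fun f _ => ?_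
  by_cases hf : ∀ s, S s → f s = s
  · congr 1
    refine Finset.prod_congr rfl fun i _ => ?_
    by_cases hi : S i
    · rw [hf i hi, hd i hi]
    · refine hAB _ _ (fun h => hi ?_) hi
      rwa [f.injective (hf _ h)] at h
  · push Not at hf
    obtain ⟨s, hs, hfs⟩ := hf
    obtain ⟨j, hj, hj1, hj2⟩ := key f s hfs
    rw [Finset.prod_eq_zero (f := fun i => A (f i) i) (Finset.mem_univ j)
        (hA s hs _ _ hj1 hj hj2),
      Finset.prod_eq_zero (f := fun i => B (f i) i) (Finset.mem_univ j)
        (hB s hs _ _ hj1 hj hj2)]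

/-- Jacobi's identity for complementary minors, in bordered form: `M` is obtained from the
invertible matrix `P` by replacing the first `k` rows and the first `l` columns. -/
theorem det_mul_det_inverse {N k l : ℕ} (hk : k ≤ N) (hl : l ≤ N)
    (P P' : Matrix (Fin N) (Fin N) R) (hP : P * P' = 1)
    (V : Fin N → Fin l → R) (Q : Fin N → Fin N → R)
    (M : Matrix (Fin N) (Fin N) R)
    (hMV : ∀ (i : Fin N) (j : Fin l), (i : ℕ) < k → M i (Fin.castLE hl j) = V i j)
    (hM0 : ∀ i j : Fin N, k ≤ (i : ℕ) → (j : ℕ) < l → M i j = 0)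
    (hMQ : ∀ i j : Fin N, (i : ℕ) < k → l ≤ (j : ℕ) → M i j = Q i j)
    (hMP : ∀ i j : Fin N, k ≤ (i : ℕ) → l ≤ (j : ℕ) → M i j = P i j) :
    M.det * P'.det = (-1) ^ l * (Matrix.fromBlocks
      (Matrix.of fun i j : Fin k => ∑ t, Q (Fin.castLE hk i) t * P' t (Fin.castLE hk j))
      (Matrix.of fun (i : Fin k) (j : Fin l) => V (Fin.castLE hk i) j)
      (Matrix.of fun (i : Fin l) (j : Fin k) => P' (Fin.castLE hl i) (Fin.castLE hk j))
      (0 : Matrix (Fin l) (Fin l) R)).det := by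
  set E : Matrix (Fin l) (Fin N) R := Matrix.of fun i j => if Fin.castLE hl i = j then 1 else 0
    with hE
  set V' : Matrix (Fin N) (Fin l) R := Matrix.of fun i j => if (i : ℕ) < k then V i j else 0
    with hV'
  set Y : Matrix (Fin N) (Fin N) R := Matrix.of fun i j => if (i : ℕ) < k then Q i j else P i j
    with hY
  set d : Fin N → R := fun j => if (j : ℕ) < l then -1 else 1 with hd
  set X : Matrix (Fin l ⊕ Fin N) (Fin l ⊕ Fin N) R := Matrix.fromBlocks 0 E V' Y with hX
  have hEE : E * E.transpose = 1 := by
    ext i j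
    simp [hE, Matrix.mul_apply, Matrix.one_apply, eq_comm]
  have hdprod : ∏ j, d j = (-1) ^ l := by
    rw [hd, Finset.prod_ite]
    simp [Fin.card_filter_val_lt, hl]
  -- Column operations turn the corner of X into the identity. Its Schur complement is M with the
  -- first l columns negated, because there the columns of Y cancel and only -V' remains.
  have hdX : X.det = (-1) ^ l * M.det := by
    have h1 : X * Matrix.fromBlocks 1 0 E.transpose 1 =
        Matrix.fromBlocks 1 E (V' + Y * E.transpose) Y := by
      rw [hX, Matrix.fromBlocks_multiply]
      simp [hEE]
    have h2 := congrArg Matrix.det h1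
    rw [Matrix.det_mul, Matrix.det_fromBlocks_zero₁₂, Matrix.det_one, Matrix.det_one, mul_one,
      mul_one, Matrix.det_fromBlocks_one₁₁] at h2
    rw [h2, ← hdprod, mul_comm, ← Matrix.det_diagonal, ← Matrix.det_mul]
    congr 1
    ext i j
    rw [Matrix.mul_diagonal, Matrix.sub_apply, Matrix.mul_apply]
    by_cases hj : (j : ℕ) < l
    · have hj' : j = Fin.castLE hl ⟨j, hj⟩ := rfl
      have hs : ∑ x, (V' + Y * E.transpose) i x * E x j = (V' + Y * E.transpose) i ⟨j, hj⟩ := by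
        rw [Finset.sum_eq_single ⟨(j : ℕ), hj⟩]
        · simp [hE]
        · intro b _ hb
          have : Fin.castLE hl b ≠ j := fun h => hb (by ext; simp [← h])
          simp [hE, this]
        · simp
      have hs2 : (Y * E.transpose) i ⟨j, hj⟩ = Y i j := by
        rw [Matrix.mul_apply]
        simp [hE]
      rw [hs, Matrix.add_apply, hs2]
      by_cases hi : (i : ℕ) < k
      · have := hMV i ⟨j, hj⟩ hi
        simp only [← hj'] at this
        simp [hV', hd, hi, hj, this]
      · simp [hV', hi, hM0 i j (not_lt.mp hi) hj]
    · have hs : ∑ x, (V' + Y * E.transpose) i x * E x j = 0 := by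
        refine Finset.sum_eq_zero fun x _ => ?_
        have : Fin.castLE hl x ≠ j := fun h => hj (by rw [← h]; simp)
        simp [hE, this]
      rw [hs]
      by_cases hi : (i : ℕ) < k
      · simp [hY, hd, hi, hj, hMQ i j hi (not_lt.mp hj)]
      · simp [hY, hd, hi, hj, hMP i j (not_lt.mp hi) (not_lt.mp hj)]
  set Z : Matrix (Fin l ⊕ Fin N) (Fin l ⊕ Fin N) R :=
    Matrix.fromBlocks 0 (E * P') V' (Y * P') with hZ
  have hXZ : X.det * P'.det = Z.det := by
    have h1 : X * Matrix.fromBlocks 1 0 0 P' = Z := by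
      rw [hX, hZ, Matrix.fromBlocks_multiply]
      simp
    have h2 := congrArg Matrix.det h1
    rwa [Matrix.det_mul, Matrix.det_fromBlocks_zero₁₂, Matrix.det_one, one_mul] at h2
  have hYP : ∀ i j : Fin N, k ≤ (i : ℕ) → (Y * P') i j = (1 : Matrix (Fin N) (Fin N) R) i j := by
    intro i j hi
    rw [← hP, Matrix.mul_apply, Matrix.mul_apply]
    simp [hY, not_lt.mpr hi]
  -- From row k on, Y agrees with P, so Y P' has identity rows there. These split off, leaving a
  -- block of size l + k.
  let p : Fin l ⊕ Fin N → Prop := Sum.elim (fun _ => True) (fun i => (i : ℕ) < k)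
  have : DecidablePred p := Classical.decPred _
  have hZp : Z.det = (Matrix.toSquareBlockProp Z p).det := by
    rw [Matrix.twoBlockTriangular_det Z p]
    · have : (Matrix.toSquareBlockProp Z fun i => ¬p i) = 1 := by
        ext ⟨i, hi⟩ ⟨j, hj⟩
        rcases i with i | i
        · exact absurd trivial hi
        rcases j with j | j
        · exact absurd trivial hj
        have := hYP i j (not_lt.mp hi)
        simpa [Matrix.toSquareBlockProp, hZ, Matrix.one_apply] using this
      rw [this, Matrix.det_one, mul_one]
    · intro i hi j hj
      rcases i with i | i
      · exact absurd trivial hi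
      have hi' : ¬(i : ℕ) < k := hi
      rcases j with j | j
      · simp [hZ, hV', hi']
      · have hj' : (j : ℕ) < k := hj
        rw [hZ, Matrix.fromBlocks_apply₂₂, hYP i j (not_lt.mp hi'), Matrix.one_apply_ne]
        rintro rfl
        exact hi' hj'
  let e : Fin k ⊕ Fin l ≃ {x // p x} :=
    { toFun := Sum.elim (fun i => ⟨Sum.inr (Fin.castLE hk i), i.2⟩) (fun j => ⟨Sum.inl j, trivial⟩)
      invFun := fun x => match x with
        | ⟨Sum.inl j, _⟩ => Sum.inr j
        | ⟨Sum.inr i, hi⟩ => Sum.inl ⟨i, hi⟩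
      left_inv := by rintro (i | j) <;> rfl
      right_inv := by rintro ⟨i | j, h⟩ <;> rfl }
  have hfin : Z.det = (Matrix.fromBlocks
      (Matrix.of fun i j : Fin k => ∑ t, Q (Fin.castLE hk i) t * P' t (Fin.castLE hk j))
      (Matrix.of fun (i : Fin k) (j : Fin l) => V (Fin.castLE hk i) j)
      (Matrix.of fun (i : Fin l) (j : Fin k) => P' (Fin.castLE hl i) (Fin.castLE hk j))
      (0 : Matrix (Fin l) (Fin l) R)).det := by
    rw [hZp, ← Matrix.det_submatrix_equiv_self e]
    congr 1
    ext i j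
    rcases i with i | i <;> rcases j with j | j <;>
      simp [e, Matrix.toSquareBlockProp, hZ, Matrix.mul_apply, hY, hV', hE]
  rw [← hfin, ← hXZ, hdX, ← mul_assoc, ← mul_assoc, ← mul_pow]
  simp

end LinearAlgebra

end DualGroth

namespace DualGroth

/-! ### Supersymmetric functions and the specialized alphabets. -/

section Supersymmetric

variable {R : Type*} [CommRing R]

theorem superE_of_neg {σ τ : Type} [Fintype σ] [Fintype τ] [DecidableEq σ] [DecidableEq τ]
    {n : ℤ} (hn : n < 0) (f : σ → R) (h : τ → R) : superE n f h = 0 := if_pos hn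

theorem superE_zero {σ τ : Type} [Fintype σ] [Fintype τ] [DecidableEq σ] [DecidableEq τ]
    (f : σ → R) (h : τ → R) : superE 0 f h = 1 := by
  simp [superE]

/-- The complete homogeneous symmetric polynomials are insensitive to additional zeros. -/
theorem aeval_hsymm_of_injective {τ τ' : Type} [Fintype τ] [Fintype τ'] [DecidableEq τ]
    [DecidableEq τ'] (g : τ → τ') (hg : Function.Injective g) (h' : τ' → R)
    (h0 : ∀ t, t ∉ Set.range g → h' t = 0) (n : ℕ) :
    MvPolynomial.aeval h' (MvPolynomial.hsymm τ' ℤ n) =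
      MvPolynomial.aeval (h' ∘ g) (MvPolynomial.hsymm τ ℤ n) := by
  simp only [MvPolynomial.hsymm, map_sum, map_multiset_prod, Multiset.map_map,
    Function.comp_def, MvPolynomial.aeval_X]
  symm
  refine Finset.sum_of_injOn (Sym.map g) (Sym.map_injective hg n).injOn (by simp) ?_ ?_
  · intro s _ hs
    have : ∃ t ∈ s, t ∉ Set.range g := by
      by_contra! hc
      apply hs
      have : CanLift τ' τ g (· ∈ Set.range g) := ⟨fun _ ht => ht⟩
      obtain ⟨r, hr⟩ := (Multiset.canLift g (· ∈ Set.range g)).prf s.1 hc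
      have hn : r.card = n := by rw [← Multiset.card_map g, hr, s.2]
      exact ⟨⟨r, hn⟩, Finset.mem_coe.mpr (Finset.mem_univ _), Subtype.ext hr⟩
    obtain ⟨t, ht, ht'⟩ := this
    exact Multiset.prod_eq_zero (Multiset.mem_map.mpr ⟨t, ht, h0 t ht'⟩)
  · intro s _
    simp [Sym.map, Multiset.map_map]

/-- Supersymmetric functions depend only on the family up to reindexing, and zeros among the
second family may be dropped. -/
theorem superE_reindex {σ σ' τ τ' : Type} [Fintype σ] [Fintype τ] [DecidableEq σ] [DecidableEq τ]
    [Fintype σ'] [Fintype τ'] [DecidableEq σ'] [DecidableEq τ'] (n : ℤ)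
    (f : σ' → R) (h : τ' → R) (e : σ → σ') (he : Function.Bijective e) (g : τ → τ')
    (hg : Function.Injective g) (h0 : ∀ t, t ∉ Set.range g → h t = 0) :
    superE n f h = superE n (f ∘ e) (h ∘ g) := by
  unfold superE
  split_ifs
  · rfl
  refine Finset.sum_congr rfl fun i _ => ?_
  rw [aeval_hsymm_of_injective g hg h h0,
    ← MvPolynomial.rename_esymm σ ℤ i (Equiv.ofBijective e he), MvPolynomial.aeval_rename]
  rfl

/-- The family on the segment `2 - j, …, m - 1 + r` of the substitution, `r ≥ 1`, consists of
`x_m`, `-α_{[j - 1]}` and `β_{[r - 1]}`; similarly for `z`. -/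
theorem superE_segment_gSpec (n : ℤ) (m i j r s : ℕ) (hr : 0 < r) (x α β : ℕ → R) :
    superE n (segment (gSpecY m x α β) (1 - j) (m - 1 + r))
        (segment (gSpecZ m α β) (1 - s) (m + i)) =
      superE n
        (Sum.elim (fun t : Fin m => x (t + 1))
          (Sum.elim (fun t : Fin j => -α (t + 1)) (fun t : Fin (r - 1) => β (t + 1))))
        (Sum.elim (fun t : Fin i => -α (t + 1)) (fun t : Fin s => β (t + 1))) := by
  -- The condition r > 0 matters here: for r = 0 the segment would stop before m and could lose x_m.
  let e : Fin m ⊕ (Fin j ⊕ Fin (r - 1)) → {t : ℤ // t ∈ Finset.Icc (1 - (j : ℤ)) (m - 1 + r)} :=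
    Sum.elim (fun t => ⟨t + 1, by rw [Finset.mem_Icc]; omega⟩)
      (Sum.elim (fun t => ⟨-t, by rw [Finset.mem_Icc]; omega⟩)
        (fun t => ⟨m + t + 1, by rw [Finset.mem_Icc]; omega⟩))
  let g : Fin i ⊕ Fin s → {t : ℤ // t ∈ Finset.Icc (1 - (s : ℤ)) (m + i)} :=
    Sum.elim (fun t => ⟨m + t + 1, by rw [Finset.mem_Icc]; omega⟩)
      (fun t => ⟨-t, by rw [Finset.mem_Icc]; omega⟩)
  have he : Function.Bijective e := by
    constructor
    · rintro (t | t | t) (t' | t' | t') h <;> simp [e, Fin.ext_iff] at h ⊢ <;> omega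
    · rintro ⟨t, ht⟩
      rw [Finset.mem_Icc] at ht
      by_cases h1 : t ≤ 0
      · refine ⟨Sum.inr (Sum.inl ⟨(-t).toNat, by omega⟩), ?_⟩
        simp [e]
        omega
      by_cases h2 : t ≤ m
      · refine ⟨Sum.inl ⟨(t - 1).toNat, by omega⟩, ?_⟩
        simp [e]
        omega
      · refine ⟨Sum.inr (Sum.inr ⟨(t - m - 1).toNat, by omega⟩), ?_⟩
        simp [e]
        omega
  have hg : Function.Injective g := by
    rintro (t | t) (t' | t') h <;> simp [g, Fin.ext_iff] at h ⊢ <;> omega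
  have h0 : ∀ t, t ∉ Set.range g → segment (gSpecZ m α β) (1 - s) (m + i) t = 0 := by
    rintro ⟨t, ht⟩ hr
    rw [Finset.mem_Icc] at ht
    by_cases h1 : t ≤ 0
    · refine absurd ⟨Sum.inr ⟨(-t).toNat, by omega⟩, ?_⟩ hr
      simp [g]
      omega
    by_cases h2 : t ≤ m
    · simp [segment, gSpecZ, h1, h2]
    · refine absurd ⟨Sum.inl ⟨(t - m - 1).toNat, by omega⟩, ?_⟩ hr
      simp [g]
      omega
  rw [superE_reindex n _ _ e he g hg h0]
  congr 1
  · funext t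
    rcases t with t | t | t
    · have h1 : ¬((t : ℤ) + 1 ≤ 0) := by omega
      have h2 : (t : ℤ) + 1 ≤ m := by omega
      have h3 : ((t : ℤ) + 1).toNat = t + 1 := by omega
      simp [e, segment, gSpecY, h1, h2, h3]
    · have h3 : (1 + (t : ℤ)).toNat = t + 1 := by omega
      simp [e, segment, gSpecY, h3]
    · have h1 : ¬((m : ℤ) + t + 1 ≤ 0) := by omega
      have h2 : ¬((m : ℤ) + t + 1 ≤ m) := by omega
      have h3 : ((m : ℤ) + t + 1 - m).toNat = t + 1 := by omega
      simp [e, segment, gSpecY, h1, h2, h3]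
  · funext t
    rcases t with t | t
    · have h1 : ¬((m : ℤ) + t + 1 ≤ 0) := by omega
      have h2 : ¬((m : ℤ) + t + 1 ≤ m) := by omega
      have h3 : ((m : ℤ) + t + 1 - m).toNat = t + 1 := by omega
      simp [g, segment, gSpecZ, h1, h2, h3]
    · have h3 : (1 + (t : ℤ)).toNat = t + 1 := by omega
      simp [g, segment, gSpecZ, h3]

end Supersymmetric

/-! ### Frobenius coordinates and the sign of the associated permutation. -/

section Frobenius

theorem lt_durfee_iff_mem (lam : YoungDiagram) (i : ℕ) :
    i < durfee lam ↔ (i, i) ∈ lam := by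
  set D : Finset ℕ := (lam.cells.filter fun p => p.1 = p.2).image Prod.fst with hD
  have hmem : ∀ i, i ∈ D ↔ (i, i) ∈ lam := by
    intro i
    simp [hD, YoungDiagram.mem_cells]
  have hcard : D.card = durfee lam := by
    rw [hD, durfee, Finset.card_image_of_injOn]
    rintro ⟨a, b⟩ ha ⟨c, d⟩ hc h
    simp at ha hc h ⊢
    omega
  have hdown : ∀ i, (i, i) ∈ lam → ∀ j ≤ i, (j, j) ∈ lam :=
    fun i hi j hj => lam.up_left_mem hj hj hi
  constructor
  · intro hi
    by_contra hc
    have : D ⊆ Finset.range i := by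
      intro j hj
      rw [hmem] at hj
      rw [Finset.mem_range]
      by_contra hij
      exact hc (hdown j hj i (not_lt.mp hij))
    have := Finset.card_le_card this
    rw [hcard, Finset.card_range] at this
    omega
  · intro hi
    have : Finset.range (i + 1) ⊆ D := by
      intro j hj
      rw [Finset.mem_range] at hj
      exact (hmem j).mpr (hdown i hi j (by omega))
    have := Finset.card_le_card this
    rw [hcard, Finset.card_range] at this
    omega

theorem lt_rowLen_of_lt_durfee {lam : YoungDiagram} {i : ℕ} (hi : i < durfee lam) :
    i < lam.rowLen i :=
  YoungDiagram.mem_iff_lt_rowLen.mp ((lt_durfee_iff_mem lam i).mp hi)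

theorem lt_colLen_iff_lt_durfee {lam : YoungDiagram} {i : ℕ} :
    i < lam.colLen i ↔ i < durfee lam :=
  YoungDiagram.mem_iff_lt_colLen.symm.trans (lt_durfee_iff_mem lam i).symm

theorem durfee_le {lam : YoungDiagram} {n : ℕ} (hn : lam.rowLen 0 ≤ n) : durfee lam ≤ n := by
  by_contra! hc
  have h1 := lt_rowLen_of_lt_durfee hc
  have h2 := lam.rowLen_anti 0 n (Nat.zero_le n)
  omega

theorem arm_lt {lam : YoungDiagram} {n : ℕ} (hn : lam.rowLen 0 ≤ n) {i : ℕ} (hi : i < n) :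
    arm lam i < n := by
  have h2 := lam.rowLen_anti 0 i (Nat.zero_le i)
  unfold arm
  omega

/-- The complement of the arms of the diagonal cells: the map sending `i` to the arm of the
`i`-th diagonal cell, or to `i - λ'_i` if there is no such cell. -/
def frobeniusFun (lam : YoungDiagram) (i : ℕ) : ℕ :=
  if i < durfee lam then arm lam i else i - lam.colLen i

theorem frobeniusFun_lt {lam : YoungDiagram} {n : ℕ} (hn : lam.rowLen 0 ≤ n) {i : ℕ} (hi : i < n) :
    frobeniusFun lam i < n := by
  unfold frobeniusFun
  split_ifs
  · exact arm_lt hn hi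
  · omega

theorem arm_strictAnti {lam : YoungDiagram} {i j : ℕ} (hij : i < j) (hj : j < durfee lam) :
    arm lam j < arm lam i := by
  have h1 := lt_rowLen_of_lt_durfee hj
  have h2 := lam.rowLen_anti i j hij.le
  unfold arm
  omega

theorem sub_colLen_strictMono {lam : YoungDiagram} {i j : ℕ} (hij : i < j) (hi : durfee lam ≤ i) :
    i - lam.colLen i < j - lam.colLen j := by
  have h1 : ¬ i < lam.colLen i := fun h => absurd (lt_colLen_iff_lt_durfee.mp h) (by omega)
  have h2 := lam.colLen_anti i j hij.le
  omega

/-- Compare both sides with j - i. If the cell (i, j) lies in λ, the arm is at least j - i and the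
other side is smaller; otherwise the arm is less than j - i and the other side is at least j - i. -/
theorem arm_ne_sub_colLen {lam : YoungDiagram} {i j : ℕ} (hi : i < durfee lam)
    (hj : durfee lam ≤ j) : arm lam i ≠ j - lam.colLen j := by
  have h1 := lt_rowLen_of_lt_durfee hi
  have h2 : ¬ j < lam.colLen j := fun h => absurd (lt_colLen_iff_lt_durfee.mp h) (by omega)
  have h3 : j < lam.rowLen i ↔ i < lam.colLen j := by
    rw [← YoungDiagram.mem_iff_lt_rowLen, YoungDiagram.mem_iff_lt_colLen]
  unfold arm
  omega

theorem frobeniusFun_injective (lam : YoungDiagram) : Function.Injective (frobeniusFun lam) := by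
  intro i j h
  by_contra hij
  wlog hlt : i < j generalizing i j
  · exact this h.symm (Ne.symm hij) (by omega)
  unfold frobeniusFun at h
  split_ifs at h with h1 h2 h2
  · have := arm_strictAnti hlt h2
    omega
  · exact arm_ne_sub_colLen h1 (not_lt.mp h2) h
  · omega
  · have := sub_colLen_strictMono hlt (not_lt.mp h1)
    omega

/-- The permutation of `0, …, n - 1` given by `frobeniusFun`. -/
noncomputable def frobeniusPerm (lam : YoungDiagram) (n : ℕ) (hn : lam.rowLen 0 ≤ n) :
    Equiv.Perm (Fin n) :=
  Equiv.ofBijective (fun i => ⟨frobeniusFun lam i, frobeniusFun_lt hn i.2⟩)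
    (Finite.injective_iff_bijective.mp fun i j h => by
      simp only [Fin.mk.injEq] at h
      exact Fin.ext (frobeniusFun_injective lam h))

theorem frobeniusPerm_val (lam : YoungDiagram) (n : ℕ) (hn : lam.rowLen 0 ≤ n) (i : Fin n) :
    (frobeniusPerm lam n hn i : ℕ) = frobeniusFun lam i := rfl

/-- Inversions are counted by their left position. Arms decrease along the diagonal, so every value
below the i-th arm occurs later, which gives exactly that many inversions. Beyond the Durfee square
the map increases and there are none. -/
theorem sign_frobeniusPerm (lam : YoungDiagram) (n : ℕ) (hn : lam.rowLen 0 ≤ n) :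
    Equiv.Perm.sign (frobeniusPerm lam n hn) =
      ∏ i : Fin (durfee lam), (-1 : ℤˣ) ^ arm lam i := by
  set f := frobeniusPerm lam n hn with hf
  have hrow : ∀ i : Fin n, ∏ j ∈ Finset.Ioi i, (if f i < f j then (1 : ℤˣ) else -1) =
      if (i : ℕ) < durfee lam then (-1) ^ arm lam i else 1 := by
    intro i
    split_ifs with hi
    · rw [Finset.prod_ite]
      simp only [Finset.prod_const, one_pow, one_mul]
      congr 1
      have hset : (Finset.Ioi i).filter (fun j => ¬f i < f j) =
          (Finset.Iio (f i)).map f.symm.toEmbedding := by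
        ext j
        simp only [Finset.mem_filter, Finset.mem_Ioi, Finset.mem_map_equiv, Equiv.symm_symm,
          Finset.mem_Iio, not_lt]
        constructor
        · rintro ⟨h1, h2⟩
          exact lt_of_le_of_ne h2 fun h => h1.ne' (f.injective h)
        · intro h
          refine ⟨?_, h.le⟩
          by_contra hc
          rcases (not_lt.mp hc).eq_or_lt with h' | h'
          · rw [h'] at h
            exact lt_irrefl _ h
          · have hj : (j : ℕ) < durfee lam := lt_trans h' hi
            rw [Fin.lt_def, hf, frobeniusPerm_val, frobeniusPerm_val, frobeniusFun, frobeniusFun,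
              if_pos hi, if_pos hj] at h
            have := arm_strictAnti (lam := lam) (i := j) (j := i) h' hi
            omega
      rw [hset, Finset.card_map, Fin.card_Iio, hf, frobeniusPerm_val, frobeniusFun, if_pos hi]
    · refine Finset.prod_eq_one fun j hj => if_pos ?_
      rw [Finset.mem_Ioi, Fin.lt_def] at hj
      rw [Fin.lt_def, hf, frobeniusPerm_val, frobeniusPerm_val, frobeniusFun, frobeniusFun,
        if_neg hi, if_neg (by omega)]
      exact sub_colLen_strictMono hj (not_lt.mp hi)
  rw [Equiv.Perm.sign_eq_prod_prod_Ioi, Finset.prod_congr rfl fun i _ => hrow i]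
  symm
  refine Finset.prod_of_injOn (Fin.castLE (durfee_le hn)) (Fin.castLE_injective _).injOn
    (by simp) ?_ (by simp)
  intro i _ hi
  refine if_neg fun h => hi ⟨⟨i, h⟩, by simp, rfl⟩

end Frobenius

end DualGroth

namespace DualGroth

/-! ### Hessenberg determinants as solutions of triangular systems. -/

section Hessenberg

variable {R : Type*} [CommRing R]

theorem det_of_fin_congr {N N' : ℕ} (h : N = N') (f : ℕ → ℕ → R) :
    (Matrix.of fun i j : Fin N => f i j).det = (Matrix.of fun i j : Fin N' => f i j).det := by
  subst h
  rfl

/-- The hook determinants compute the solution `w` of `w P = q` for the unitriangular matrix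
`P = (W (s + 1) t)`. -/
theorem det_cons_hessenberg {W : ℤ → ℤ → R} (hW0 : ∀ s t, t < s - 1 → W s t = 0)
    (hW1 : ∀ s, W s (s - 1) = 1) {n a u : ℕ} (hau : a ≤ u) (hun : u < n) (w : Fin n → R)
    (q : ℕ → R) (hq : ∀ t : Fin n, ∑ s : Fin n, w s * W ((s : ℕ) + 1) (t : ℕ) = q t)
    (hw : ∀ s : Fin n, (s : ℕ) < a → w s = 0) :
    (Matrix.of fun i j : Fin (u - a + 1) =>
      (Fin.cons (q (a + j)) (fun s : Fin (u - a) => W ((a + s : ℕ) + 1) (a + j : ℕ)) :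
        Fin (u - a + 1) → R) i).det = (-1) ^ (u - a) * w ⟨u, hun⟩ := by
  have h := det_cons_combination
    (fun i j : Fin (u - a + 1) => W ((a + i : ℕ) + 1) (a + j : ℕ))
    (fun i j hij => hW0 _ _ (by rw [Fin.lt_def] at hij; push_cast; omega))
    (fun i => by convert hW1 _ using 2; ring)
    (fun i => w ⟨a + i, by omega⟩) (fun j => q (a + j)) (by
      intro t
      rw [← hq ⟨a + t, by omega⟩]
      refine Finset.sum_of_injOn (fun i : Fin (u - a + 1) => (⟨a + i, by omega⟩ : Fin n))
        (fun i _ j _ hij => by simpa [Fin.ext_iff] using hij) (by simp) ?_ (fun i _ => rfl)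
      intro s _ hs
      -- The system truncates to the window from a to u: below it w vanishes, and above it W(s + 1,
      -- t) = 0 since t ≤ u < s.
      by_cases h1 : (s : ℕ) < a
      · rw [hw s h1, zero_mul]
      · rw [hW0, mul_zero]
        have : u < s := by
          by_contra hc
          exact hs ⟨⟨s - a, by omega⟩, by simp, by simp [Fin.ext_iff]; omega⟩
        push_cast
        omega)
  simp only [Fin.val_castSucc, Fin.val_last] at h
  rw [h]
  congr 3
  omega

end Hessenberg

/-! ### Extreme cells of diagonals, and column lengths and contents of hooks and rectangles. -/

section Shapes

theorem content_usual (lam mu : YoungDiagram) (h : mu ≤ lam) (i j : ℤ) :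
    (RShape.usual lam mu h).content i j = j - i := by
  simp [RShape.content, RShape.usual]

theorem mem_diagonal_usual {lam mu : YoungDiagram} {h : mu ≤ lam} {c : ℤ} {i j : ℕ} :
    (i, j) ∈ (RShape.usual lam mu h).diagonal c ↔
      i < lam.colLen j ∧ mu.colLen j ≤ i ∧ (j : ℤ) - i = c := by
  rw [RShape.diagonal, Finset.mem_filter, content_usual, RShape.cells, Finset.mem_sdiff]
  simp only [RShape.usual, YoungDiagram.mem_cells, YoungDiagram.mem_iff_lt_colLen, not_lt, and_assoc]

/-- Going up-left along the diagonal from the top cell of a column leads into μ, whose column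
lengths weakly decrease. Hence the induced lower flag at this content is the original flag of column
j. -/
theorem minCell_usual {lam mu : YoungDiagram} (h : mu ≤ lam) {j : ℕ}
    (hj : mu.colLen j < lam.colLen j) :
    (RShape.usual lam mu h).minCell ((j : ℤ) - mu.colLen j) = (mu.colLen j, j) := by
  have hmem : (mu.colLen j, j) ∈ (RShape.usual lam mu h).diagonal ((j : ℤ) - mu.colLen j) :=
    mem_diagonal_usual.mpr ⟨hj, le_rfl, rfl⟩
  have hmin : ∀ i' j', (i', j') ∈ (RShape.usual lam mu h).diagonal ((j : ℤ) - mu.colLen j) →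
      mu.colLen j ≤ i' ∧ j ≤ j' := by
    intro i' j' hij
    obtain ⟨-, h2, h3⟩ := mem_diagonal_usual.mp hij
    by_contra hc
    have := mu.colLen_anti j' j (by omega)
    omega
  refine Prod.ext (IsLeast.csInf_eq ⟨⟨_, hmem⟩, ?_⟩) (IsLeast.csInf_eq ⟨⟨_, hmem⟩, ?_⟩)
  · rintro i ⟨j', hij⟩
    exact (hmin _ _ hij).1
  · rintro j' ⟨i, hij⟩
    exact (hmin _ _ hij).2

/-- Dually, going down-right from the bottom cell of a column leaves λ, so the induced upper flag is
the original one. -/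
theorem maxCell_usual {lam mu : YoungDiagram} (h : mu ≤ lam) {j : ℕ}
    (hj : mu.colLen j < lam.colLen j) :
    (RShape.usual lam mu h).maxCell ((j : ℤ) - lam.colLen j + 1) = (lam.colLen j - 1, j) := by
  have hmem : (lam.colLen j - 1, j) ∈
      (RShape.usual lam mu h).diagonal ((j : ℤ) - lam.colLen j + 1) :=
    mem_diagonal_usual.mpr ⟨by omega, by omega, by omega⟩
  have hmax : ∀ p ∈ (RShape.usual lam mu h).diagonal ((j : ℤ) - lam.colLen j + 1),
      p.1 ≤ lam.colLen j - 1 ∧ p.2 ≤ j := by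
    rintro ⟨i', j'⟩ hij
    obtain ⟨h1, -, h3⟩ := mem_diagonal_usual.mp hij
    by_contra hc
    have := lam.colLen_anti j j' (by omega)
    omega
  refine Prod.ext (le_antisymm (Finset.sup_le fun p hp => (hmax p hp).1) ?_)
    (le_antisymm (Finset.sup_le fun p hp => (hmax p hp).2) ?_)
  · exact Finset.le_sup (f := Prod.fst) hmem
  · exact Finset.le_sup (f := Prod.snd) hmem

theorem mem_hook {u v i j : ℕ} : (i, j) ∈ hook u v ↔ (i ≤ v ∧ j = 0) ∨ (i = 0 ∧ j ≤ u) := by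
  rw [← YoungDiagram.mem_cells]
  simp [hook]
  omega

theorem mem_rect {p q i j : ℕ} : (i, j) ∈ rect p q ↔ i < p ∧ j < q := by
  rw [← YoungDiagram.mem_cells]
  simp [rect]

theorem rowLen_hook (u v : ℕ) : (hook u v).rowLen 0 = u + 1 :=
  eq_of_forall_lt_iff fun j => by rw [← YoungDiagram.mem_iff_lt_rowLen, mem_hook]; omega

theorem colLen_hook_zero (u v : ℕ) : (hook u v).colLen 0 = v + 1 :=
  eq_of_forall_lt_iff fun j => by rw [← YoungDiagram.mem_iff_lt_colLen, mem_hook]; omega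

theorem colLen_hook_succ {u v j : ℕ} (hj : j < u) : (hook u v).colLen (j + 1) = 1 :=
  eq_of_forall_lt_iff fun j => by rw [← YoungDiagram.mem_iff_lt_colLen, mem_hook]; omega

theorem rowLen_rect {p : ℕ} (hp : 0 < p) (q : ℕ) : (rect p q).rowLen 0 = q :=
  eq_of_forall_lt_iff fun j => by rw [← YoungDiagram.mem_iff_lt_rowLen, mem_rect]; omega

theorem colLen_rect {q j : ℕ} (p : ℕ) (hj : j < q) : (rect p q).colLen j = p :=
  eq_of_forall_lt_iff fun j => by rw [← YoungDiagram.mem_iff_lt_colLen, mem_rect]; omega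

theorem colLen_bot (j : ℕ) : (⊥ : YoungDiagram).colLen j = 0 :=
  eq_of_forall_lt_iff fun i => by
    rw [← YoungDiagram.mem_iff_lt_colLen]
    simp [YoungDiagram.notMem_bot]

theorem topContent_straight (lam : YoungDiagram) (r : ℤ) (j : ℕ) :
    (RShape.straight lam r).topContent j = j + (r - 1 + lam.colLen 0) := by
  simp [RShape.topContent, RShape.content, RShape.straight, colLen_bot]

theorem botContent_straight (lam : YoungDiagram) (r : ℤ) (j : ℕ) :
    (RShape.straight lam r).botContent j = j - lam.colLen j + (r + lam.colLen 0) := by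
  simp only [RShape.botContent, RShape.content, RShape.straight]
  ring

end Shapes

/-! ### Strip weights, and all determinants expressed through them. -/

section Weights

variable {R : Type*} [CommRing R]

/-- The lower flag induced by `flagA` at the content `c`. -/
noncomputable def lowerFlag (lam mu : YoungDiagram) (h : mu ≤ lam) (c : ℤ) : ℤ :=
  let p := (RShape.usual lam mu h).minCell c
  flagA p.2 - ((mu.colLen p.2 : ℤ) + 1) + ((p.1 : ℤ) + 1)

/-- The upper flag induced by `flagB` at the content `c`. -/
def upperFlag (lam mu : YoungDiagram) (h : mu ≤ lam) (m : ℕ) (c : ℤ) : ℤ :=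
  let p := (RShape.usual lam mu h).maxCell c
  flagB lam m p.2 - (lam.colLen p.2 : ℤ) + ((p.1 : ℤ) + 1)

/-- The enumerator of the vertical strip with contents from `s` to `t`, with the induced flags. -/
noncomputable def stripWeight (lam mu : YoungDiagram) (h : mu ≤ lam) (m : ℕ) (x α β : ℕ → R)
    (s t : ℤ) : R :=
  superE (t - s + 1)
    (segment (gSpecY m x α β) (lowerFlag lam mu h t) (upperFlag lam mu h m s))
    (segment (gSpecZ m α β) (lowerFlag lam mu h t + t) (upperFlag lam mu h m s + s))

variable (lam mu : YoungDiagram) (h : mu ≤ lam) (m : ℕ) (x α β : ℕ → R)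

theorem stripWeight_of_lt (s t : ℤ) (hst : t < s - 1) : stripWeight lam mu h m x α β s t = 0 :=
  superE_of_neg (by omega) _ _

theorem stripWeight_sub_one (s : ℤ) : stripWeight lam mu h m x α β s (s - 1) = 1 := by
  have h0 : s - 1 - s + 1 = 0 := by ring
  rw [stripWeight, h0, superE_zero]

theorem superE_segment_congr {n n' a a' b b' c c' d d' : ℤ} (y z : ℤ → R) (hn : n = n')
    (ha : a = a') (hb : b = b') (hc : c = c') (hd : d = d') :
    superE n (segment y a b) (segment z c d) = superE n' (segment y a' b') (segment z c' d') := by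
  subst hn ha hb hc hd
  rfl

/-- The induced flags depend on a column only through its top or bottom content, and the degree of
an entry is the top content minus the bottom content plus 1. So the shape enters only through these
contents. -/
theorem ribbonEnum_eq_det (ρ : RShape) :
    ribbonEnum lam mu h ρ m x α β = (Matrix.of fun i j : Fin ρ.numCols =>
      stripWeight lam mu h m x α β (ρ.botContent i) (ρ.topContent j)).det := by
  refine congrArg Matrix.det ?_
  ext i j
  refine superE_segment_congr _ _ ?_ rfl rfl rfl rfl
  simp only [RShape.topContent, RShape.botContent, RShape.content]
  ring

theorem stripWeight_columns {i j : ℕ} (hi : mu.colLen i < lam.colLen i)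
    (hj : mu.colLen j < lam.colLen j) :
    stripWeight lam mu h m x α β ((i : ℤ) - lam.colLen i + 1) ((j : ℤ) - mu.colLen j) =
      superE ((lam.colLen i : ℤ) - i - mu.colLen j + j)
        (Sum.elim (fun t : Fin m => x (t + 1))
          (Sum.elim (fun t : Fin j => -α (t + 1)) (fun t : Fin (lam.colLen i - 1) => β (t + 1))))
        (Sum.elim (fun t : Fin i => -α (t + 1)) (fun t : Fin (mu.colLen j) => β (t + 1))) := by
  rw [← superE_segment_gSpec _ _ _ _ _ _ (by omega)]
  have hl : lowerFlag lam mu h ((j : ℤ) - mu.colLen j) = 1 - j := by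
    simp only [lowerFlag, minCell_usual h hj, flagA]
    ring
  have hu : upperFlag lam mu h m ((i : ℤ) - lam.colLen i + 1) = m - 1 + lam.colLen i := by
    simp only [upperFlag, maxCell_usual h hi, flagB]
    push_cast [show 1 ≤ lam.colLen i by omega]
    ring
  refine superE_segment_congr _ _ (by ring) hl hu ?_ ?_
  · rw [hl]; ring
  · rw [hu]; ring

/-- For nonempty columns the entries agree by `stripWeight_columns`. At an empty column of λ/μ the
induced flags need not be the original ones, but there both matrices are block triangular with
diagonal entry 1, so the discrepancy does not affect the determinant. -/
theorem dualGroth_eq_det (n : ℕ) :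
    dualGroth lam mu n m x α β = (Matrix.of fun i j : Fin n => stripWeight lam mu h m x α β
      ((i : ℕ) - lam.colLen i + 1) ((j : ℕ) - mu.colLen j)).det := by
  -- Here λ'_i ≤ λ'_s = μ'_s ≤ μ'_j, so the degree is at most j - i.
  have hzero : ∀ s : Fin n, lam.colLen s = mu.colLen s → ∀ i j : Fin n, s ≤ i → j ≤ s →
      ¬(i = s ∧ j = s) → (lam.colLen i : ℤ) - i - mu.colLen j + j < 0 := by
    intro s hs i j hi hj hij
    rw [Fin.le_def] at hi hj
    rw [Fin.ext_iff, Fin.ext_iff] at hij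
    have h1 := lam.colLen_anti s i hi
    have h2 := mu.colLen_anti j s hj
    omega
  have hle : ∀ i, mu.colLen i ≤ lam.colLen i := by
    intro i
    by_contra! hc
    exact absurd (YoungDiagram.mem_iff_lt_colLen.mp
      (h (YoungDiagram.mem_iff_lt_colLen.mpr hc))) (lt_irrefl _)
  refine det_congr_of_blockTriangular _ _ (fun s => lam.colLen s = mu.colLen s) ?_ ?_ ?_ ?_
  · intro s hs i j hi hj hij
    exact superE_of_neg (hzero s hs i j hi hj hij) _ _
  · intro s hs i j hi hj hij
    have := hzero s hs i j hi hj hij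
    exact stripWeight_of_lt lam mu h m x α β _ _ (by omega)
  · intro s hs
    have h0 : (lam.colLen s : ℤ) - s - mu.colLen s + s = 0 := by rw [hs]; ring
    have h1 : ((s : ℕ) : ℤ) - mu.colLen s = ((s : ℕ) - lam.colLen s + 1) - 1 := by rw [hs]; ring
    rw [Matrix.of_apply, Matrix.of_apply, h0, superE_zero, h1, stripWeight_sub_one]
  · intro i j hi hj
    exact (stripWeight_columns lam mu h m x α β (lt_of_le_of_ne (hle i) (Ne.symm hi))
      (lt_of_le_of_ne (hle j) (Ne.symm hj))).symm

/-- The conventions 1 for an empty strip and 0 for an undefined one are the values of W at t = s - 1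
and at t < s - 1. -/
theorem vertEntry_eq (i j : ℕ) : vertEntry lam mu h m x α β i j =
    stripWeight lam mu h m x α β (-(leg lam i : ℤ)) (-(leg mu j : ℤ) - 1) := by
  unfold vertEntry
  split_ifs with hlt
  · exact (stripWeight_of_lt _ _ _ _ _ _ _ _ _ (by omega)).symm
  rw [ribbonEnum_eq_det]
  rcases (not_lt.mp hlt).eq_or_lt with heq | hlt'
  · have h0 : (RShape.straight (rect (leg lam i - leg mu j) 1) (-(leg lam i : ℤ))).numCols = 0 :=
      eq_of_forall_lt_iff fun r => by
        simp only [RShape.numCols, RShape.straight]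
        rw [← YoungDiagram.mem_iff_lt_rowLen, mem_rect]
        omega
    rw [det_of_fin_congr h0 (fun a b => stripWeight lam mu h m x α β
      ((RShape.straight (rect (leg lam i - leg mu j) 1) (-(leg lam i : ℤ))).botContent a)
      ((RShape.straight (rect (leg lam i - leg mu j) 1) (-(leg lam i : ℤ))).topContent b)),
      Matrix.det_fin_zero, heq, stripWeight_sub_one]
  · have h1 : (RShape.straight (rect (leg lam i - leg mu j) 1) (-(leg lam i : ℤ))).numCols = 1 :=
      rowLen_rect (by omega) 1
    rw [det_of_fin_congr h1 (fun a b => stripWeight lam mu h m x α β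
      ((RShape.straight (rect (leg lam i - leg mu j) 1) (-(leg lam i : ℤ))).botContent a)
      ((RShape.straight (rect (leg lam i - leg mu j) 1) (-(leg lam i : ℤ))).topContent b)),
      Matrix.det_fin_one, Matrix.of_apply, botContent_straight, topContent_straight]
    simp only [Fin.val_zero, colLen_rect _ zero_lt_one]
    push_cast [hlt'.le]
    congr 1 <;> ring

/-- The hook entries in terms of the solution `w` of the unitriangular system. -/
theorem hookEntry_eq {n : ℕ} (i j : ℕ) (hj : arm lam j < n) (w : Fin n → R)
    (hw : ∀ t : Fin n, ∑ s : Fin n, w s * stripWeight lam mu h m x α β ((s : ℕ) + 1) (t : ℕ) =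
      stripWeight lam mu h m x α β (-(leg lam i : ℤ)) (t : ℕ)) :
    hookEntry lam mu h m x α β i j = (-1) ^ arm lam j * w ⟨arm lam j, hj⟩ := by
  set u := arm lam j
  set v := leg lam i
  have h1 : (RShape.straight (hook u v) (-(v : ℤ))).numCols = u + 1 := rowLen_hook u v
  have h2 := det_cons_hessenberg (stripWeight_of_lt lam mu h m x α β)
    (stripWeight_sub_one lam mu h m x α β) (Nat.zero_le u) hj w
    (fun t => stripWeight lam mu h m x α β (-(v : ℤ)) t) hw (by simp)
  rw [hookEntry, ribbonEnum_eq_det, det_of_fin_congr h1 (fun a b => stripWeight lam mu h m x α β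
      ((RShape.straight (hook u v) (-(v : ℤ))).botContent a)
      ((RShape.straight (hook u v) (-(v : ℤ))).topContent b))]
  simp only [Nat.sub_zero, Nat.zero_add] at h2
  rw [← h2]
  congr 1
  ext a b
  rw [Matrix.of_apply, Matrix.of_apply, botContent_straight, topContent_straight,
    colLen_hook_zero]
  -- The first column of the hook runs from content -v up to 0 and gives the row q. Each later
  -- column is a single cell and gives a row of P.
  refine Fin.cases ?_ (fun a => ?_) a
  · rw [Fin.cons_zero, Fin.val_zero, colLen_hook_zero]
    push_cast
    congr 1 <;> ring
  · rw [Fin.cons_succ, Fin.val_succ, colLen_hook_succ a.2]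
    push_cast
    congr 1 <;> ring

/-- The horizontal entries in terms of a row `w` of the inverse of the unitriangular matrix. -/
theorem horizEntry_eq {n : ℕ} (i j : ℕ) (hj : arm lam j < n) (w : Fin n → R)
    (hw : ∀ t : Fin n, ∑ s : Fin n, w s * stripWeight lam mu h m x α β ((s : ℕ) + 1) (t : ℕ) =
      if (t : ℕ) = arm mu i then 1 else 0)
    (hw0 : ∀ s : Fin n, (s : ℕ) < arm mu i → w s = 0) :
    horizEntry lam mu h m x α β i j =
      (-1) ^ arm mu i * w ⟨arm lam j, hj⟩ * (-1) ^ arm lam j := by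
  set u := arm lam j with hu
  set c := arm mu i with hc
  unfold horizEntry
  change (if u < c then 0 else ribbonEnum lam mu h
    (RShape.straight (rect 1 (u - c)) ((c : ℤ) + 1)) m x α β) = _
  split_ifs with hlt
  · rw [hw0 _ hlt]
    ring
  have hcu : c ≤ u := not_lt.mp hlt
  have h1 : (RShape.straight (rect 1 (u - c)) ((c : ℤ) + 1)).numCols = u - c :=
    rowLen_rect zero_lt_one _
  have h2 := det_cons_hessenberg (stripWeight_of_lt lam mu h m x α β)
    (stripWeight_sub_one lam mu h m x α β) hcu hj w (fun t => if t = c then 1 else 0) hw hw0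
  -- The right-hand side is a unit vector at c, so the top row of the window is (1, 0, …, 0).
  -- Expanding along it leaves the determinant of the row with contents c + 1, …, u.
  rw [Matrix.det_succ_row_zero, Finset.sum_eq_single 0] at h2
  rotate_left
  · intro b _ hb
    simp [hb]
  · simp
  have h3 : ((-1 : R)) ^ c * w ⟨u, hj⟩ * (-1) ^ u = (-1) ^ (u - c) * w ⟨u, hj⟩ := by
    have : (-1 : R) ^ u = (-1) ^ c * (-1) ^ (u - c) := by rw [← pow_add, Nat.add_sub_cancel' hcu]
    rw [this]
    calc (-1 : R) ^ c * w ⟨u, hj⟩ * ((-1) ^ c * (-1) ^ (u - c))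
        = ((-1) ^ c * (-1) ^ c) * ((-1) ^ (u - c) * w ⟨u, hj⟩) := by ring
      _ = _ := by rw [← mul_pow]; simp
  rw [h3, ← h2, ribbonEnum_eq_det, det_of_fin_congr h1 (fun a b =>
      stripWeight lam mu h m x α β
      ((RShape.straight (rect 1 (u - c)) ((c : ℤ) + 1)).botContent a)
      ((RShape.straight (rect 1 (u - c)) ((c : ℤ) + 1)).topContent b))]
  simp only [Fin.val_zero, pow_zero, Matrix.of_apply, Fin.cons_zero, add_zero, if_true, one_mul]
  congr 1
  ext a b
  rw [Matrix.of_apply, botContent_straight, topContent_straight, colLen_rect 1 a.2,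
    colLen_rect 1 (Nat.zero_lt_of_lt a.2)]
  simp only [Matrix.submatrix_apply, Matrix.of_apply, Fin.cons_succ, Fin.zero_succAbove,
    Fin.val_succ]
  push_cast
  congr 1 <;> ring

end Weights

end DualGroth

/-! ### Assembly: Jacobi's identity applied to the matrix of strip weights. -/

namespace DualGroth

/-- The Giambelli-type formula: the complementary-minor identity for the unitriangular matrix of
strip weights. -/
theorem dualGroth_eq_det_frobenius {R : Type*} [CommRing R] (lam mu : YoungDiagram) (h : mu ≤ lam)
    (m n : ℕ) (hn : lam.rowLen 0 ≤ n) (x α β : ℕ → R) :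
    dualGroth lam mu n m x α β =
      (-1) ^ durfee mu *
        (Matrix.fromBlocks
          (Matrix.of fun i j : Fin (durfee lam) =>
            hookEntry lam mu h m x α β i j)
          (Matrix.of fun (i : Fin (durfee lam)) (j : Fin (durfee mu)) =>
            vertEntry lam mu h m x α β i j)
          (Matrix.of fun (i : Fin (durfee mu)) (j : Fin (durfee lam)) =>
            horizEntry lam mu h m x α β i j)
          (0 : Matrix (Fin (durfee mu)) (Fin (durfee mu)) R)).det := by
  have hn' : mu.rowLen 0 ≤ n := by
    by_contra! hc
    exact absurd (YoungDiagram.mem_iff_lt_rowLen.mp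
      (h (YoungDiagram.mem_iff_lt_rowLen.mpr hc))) (not_lt.mpr hn)
  have hk := durfee_le hn
  have hl := durfee_le hn'
  set W := stripWeight lam mu h m x α β with hWdef
  have hW0 : ∀ s t, t < s - 1 → W s t = 0 := stripWeight_of_lt lam mu h m x α β
  have hW1 : ∀ s, W s (s - 1) = 1 := stripWeight_sub_one lam mu h m x α β
  set P : Matrix (Fin n) (Fin n) R := Matrix.of fun s t => W ((s : ℕ) + 1) (t : ℕ) with hP
  have hPlow : ∀ i j, j < i → P i j = 0 := by
    intro i j hij
    rw [Fin.lt_def] at hij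
    exact hW0 _ _ (by omega)
  have hPdet : P.det = 1 := det_unitriangular P hPlow fun i => by
    simpa [hP] using hW1 ((i : ℕ) + 1)
  have hunit : IsUnit P.det := by rw [hPdet]; exact isUnit_one
  have hPinv : P * P⁻¹ = 1 := Matrix.mul_nonsing_inv P hunit
  have hinvP : P⁻¹ * P = 1 := Matrix.nonsing_inv_mul P hunit
  have hinvdet : P⁻¹.det = 1 := by
    have := congrArg Matrix.det hPinv
    rwa [Matrix.det_mul, hPdet, one_mul, Matrix.det_one] at this
  have hinvlow : ∀ i j, j < i → P⁻¹ i j = 0 := by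
    let _ := Matrix.invertibleOfIsUnitDet P hunit
    have hb : P.BlockTriangular id := fun i j hij => hPlow i j hij
    exact fun i j hij => Matrix.blockTriangular_inv_of_blockTriangular hb hij
  set f := frobeniusPerm lam n hn with hf
  set g := frobeniusPerm mu n hn' with hg
  have hfarm : ∀ j : Fin (durfee lam),
      f (Fin.castLE hk j) = ⟨arm lam j, arm_lt hn (j.2.trans_le hk)⟩ := by
    intro j
    ext
    rw [hf, frobeniusPerm_val, frobeniusFun]
    exact if_pos j.2
  have hgarm : ∀ j : Fin (durfee mu),
      ((g (Fin.castLE hl j) : Fin n) : ℕ) = arm mu j := by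
    intro j
    rw [hg, frobeniusPerm_val, frobeniusFun]
    exact if_pos j.2
  have hneg : ∀ (nu : YoungDiagram) (i : ℕ), i < durfee nu →
      (i : ℤ) - nu.colLen i = -(leg nu i : ℤ) - 1 := by
    intro nu i hi
    have := lt_colLen_iff_lt_durfee.mpr hi
    unfold leg
    omega
  have hpos : ∀ (nu : YoungDiagram) (i : ℕ), durfee nu ≤ i →
      (i : ℤ) - nu.colLen i = (frobeniusFun nu i : ℕ) := by
    intro nu i hi
    have : ¬ i < nu.colLen i := fun h => absurd (lt_colLen_iff_lt_durfee.mp h) (by omega)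
    rw [frobeniusFun, if_neg (by omega)]
    omega
  -- Permuting by f and g puts the arms of λ and μ first, so that the replaced rows and columns of P
  -- are the initial ones.
  have hmain := det_mul_det_inverse hk hl (P.submatrix f g) (P⁻¹.submatrix g f)
    (by rw [Matrix.submatrix_mul_equiv, hPinv, Matrix.submatrix_one_equiv])
    (fun i j => W (-(leg lam i : ℤ)) (-(leg mu j : ℤ) - 1))
    (fun i t => W (-(leg lam i : ℤ)) ((g t : Fin n) : ℕ))
    (Matrix.of fun i j : Fin n => W ((i : ℕ) - lam.colLen i + 1) ((j : ℕ) - mu.colLen j))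
    (by
      intro i j hi
      rw [Matrix.of_apply, hneg lam i hi, Fin.val_castLE, hneg mu j j.2]
      congr 1
      ring)
    (by
      intro i j hi hj
      rw [Matrix.of_apply, hpos lam i hi, hneg mu j hj]
      exact hW0 _ _ (by omega))
    (by
      intro i j hi hj
      rw [Matrix.of_apply, hneg lam i hi, hpos mu j hj]
      congr 1
      ring)
    (by
      intro i j hi hj
      rw [Matrix.of_apply, hpos lam i hi, hpos mu j hj]
      rfl)
  have hsign : ∀ (nu : YoungDiagram) (hnu : nu.rowLen 0 ≤ n),
      ((Equiv.Perm.sign (frobeniusPerm nu n hnu) : ℤ) : R) =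
        ∏ i : Fin (durfee nu), (-1 : R) ^ arm nu i := by
    intro nu hnu
    rw [sign_frobeniusPerm]
    simp
  have hsq : ∀ (k : ℕ) (a : Fin k → ℕ),
      (∏ i, (-1 : R) ^ a i) * ∏ i, (-1 : R) ^ a i = 1 := by
    intro k a
    rw [← Finset.prod_mul_distrib]
    exact Finset.prod_eq_one fun i _ => by rw [← mul_pow]; simp
  have hdetPQ : (P⁻¹.submatrix g f).det =
      (∏ i : Fin (durfee mu), (-1 : R) ^ arm mu i) *
        ∏ i : Fin (durfee lam), (-1 : R) ^ arm lam i := by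
    have : P⁻¹.submatrix g f = (P⁻¹.submatrix g id).submatrix id f := rfl
    rw [this, Matrix.det_permute', Matrix.det_permute, hinvdet, hf, hg, hsign, hsign]
    ring
  have hrow : ∀ (i j : Fin n), ∑ s, P⁻¹ i s * W ((s : ℕ) + 1) (j : ℕ) = if i = j then 1 else 0 := by
    intro i j
    have := congrFun (congrFun hinvP i) j
    rwa [Matrix.mul_apply, Matrix.one_apply] at this
  set B := Matrix.fromBlocks
      (Matrix.of fun i j : Fin (durfee lam) =>
        ∑ t, W (-(leg lam (Fin.castLE hk i) : ℤ)) ((g t : Fin n) : ℕ) *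
          P⁻¹.submatrix g f t (Fin.castLE hk j))
      (Matrix.of fun (i : Fin (durfee lam)) (j : Fin (durfee mu)) =>
        W (-(leg lam (Fin.castLE hk i) : ℤ)) (-(leg mu j : ℤ) - 1))
      (Matrix.of fun (i : Fin (durfee mu)) (j : Fin (durfee lam)) =>
        P⁻¹.submatrix g f (Fin.castLE hl i) (Fin.castLE hk j))
      (0 : Matrix (Fin (durfee mu)) (Fin (durfee mu)) R) with hB
  -- The Giambelli matrix is B with its lower rows scaled by (-1)^{c_i} and its left columns by
  -- (-1)^{u_j}.
  have hT : (Matrix.fromBlocks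
          (Matrix.of fun i j : Fin (durfee lam) =>
            hookEntry lam mu h m x α β i j)
          (Matrix.of fun (i : Fin (durfee lam)) (j : Fin (durfee mu)) =>
            vertEntry lam mu h m x α β i j)
          (Matrix.of fun (i : Fin (durfee mu)) (j : Fin (durfee lam)) =>
            horizEntry lam mu h m x α β i j)
          (0 : Matrix (Fin (durfee mu)) (Fin (durfee mu)) R)) =
      Matrix.diagonal (Sum.elim (fun _ : Fin (durfee lam) => (1 : R)) fun i : Fin (durfee mu) => (-1) ^ arm mu i) * B *
        Matrix.diagonal (Sum.elim (fun j : Fin (durfee lam) => (-1 : R) ^ arm lam j)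
          fun _ : Fin (durfee mu) => 1) := by
    ext i j
    rw [Matrix.mul_diagonal, Matrix.diagonal_mul]
    rcases i with i | i <;> rcases j with j | j
    · have hsum : B (Sum.inl i) (Sum.inl j) =
          ∑ t : Fin n, W (-(leg lam i : ℤ)) (t : ℕ) * P⁻¹ t (f (Fin.castLE hk j)) := by
        rw [← Equiv.sum_comp g]
        rfl
      -- The solution of w P = q is w = q P⁻¹, with q the row of W at s = -v_i.
      have hw : ∀ t : Fin n, ∑ s : Fin n, (∑ r : Fin n, W (-(leg lam i : ℤ)) (r : ℕ) *
          P⁻¹ r s) * W ((s : ℕ) + 1) (t : ℕ) = W (-(leg lam i : ℤ)) (t : ℕ) := by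
        intro t
        simp_rw [Finset.sum_mul, mul_assoc]
        rw [Finset.sum_comm]
        simp_rw [← Finset.mul_sum, hrow]
        simp
      have := hookEntry_eq lam mu h m x α β i j
        (arm_lt hn (j.2.trans_le hk)) _ hw
      rw [hsum, hfarm, Matrix.fromBlocks_apply₁₁, Matrix.of_apply, this, Sum.elim_inl,
        Sum.elim_inl, one_mul, mul_comm]
    · simp [hB, vertEntry_eq, hWdef]
    · have := horizEntry_eq lam mu h m x α β i j
        (arm_lt hn (j.2.trans_le hk))
        (fun s => P⁻¹ (g (Fin.castLE hl i)) s)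
        (by
          intro t
          rw [hrow, ← hgarm i]
          simp only [Fin.ext_iff, eq_comm])
        (by
          intro s hs
          exact hinvlow _ _ (by rw [Fin.lt_def, hgarm i]; exact hs))
      rw [Matrix.fromBlocks_apply₂₁, Matrix.of_apply, this, hB, Matrix.fromBlocks_apply₂₁,
        Matrix.of_apply, Matrix.submatrix_apply, hfarm, Sum.elim_inl, Sum.elim_inr]
    · simp [hB]
  rw [hT, Matrix.det_mul, Matrix.det_mul, Matrix.det_diagonal, Matrix.det_diagonal,
    Fintype.prod_sum_type, Fintype.prod_sum_type, dualGroth_eq_det lam mu h m x α β n]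
  simp only [Sum.elim_inl, Sum.elim_inr, Finset.prod_const_one, one_mul, mul_one]
  rw [hdetPQ] at hmain
  have h1 := hsq _ fun i : Fin (durfee mu) => arm mu i
  have h2 := hsq _ fun i : Fin (durfee lam) => arm lam i
  set a := ∏ i : Fin (durfee mu), (-1 : R) ^ arm mu i
  set b := ∏ i : Fin (durfee lam), (-1 : R) ^ arm lam i
  set D := (Matrix.of fun i j : Fin n =>
    W ((i : ℕ) - lam.colLen i + 1) ((j : ℕ) - mu.colLen j)).det
  have h3 : D * (a * b) = (-1) ^ durfee mu * B.det := hmain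
  -- The sign products satisfy a² = b² = 1, so the permutation signs cancel the row and column
  -- scalings.
  linear_combination (a * b) * h3 - D * b * b * h1 - D * h2

end DualGroth

theorem mainTheorem7 {R : Type*} [CommRing R] (lam mu : YoungDiagram) (h : mu ≤ lam)
    (m n : ℕ) (hn : lam.rowLen 0 ≤ n) (x α β : ℕ → R) :
    DualGroth.dualGroth lam mu n m x α β =
      (-1) ^ DualGroth.durfee mu *
        (Matrix.fromBlocks
          (Matrix.of fun i j : Fin (DualGroth.durfee lam) =>
            DualGroth.hookEntry lam mu h m x α β i j)
          (Matrix.of fun (i : Fin (DualGroth.durfee lam)) (j : Fin (DualGroth.durfee mu)) =>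
            DualGroth.vertEntry lam mu h m x α β i j)
          (Matrix.of fun (i : Fin (DualGroth.durfee mu)) (j : Fin (DualGroth.durfee lam)) =>
            DualGroth.horizEntry lam mu h m x α β i j)
          (0 : Matrix (Fin (DualGroth.durfee mu)) (Fin (DualGroth.durfee mu)) R)).det :=
  DualGroth.dualGroth_eq_det_frobenius lam mu h m n hn x α β
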